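/- Let $H$ be Hofstadter's $H$ sequence, defined by $H(0)=0$, $H(1)=1$ and $H(n)=n-H(H(H(n-1)))$ for $n>1$. Let $\alpha$ be the real root of $x^3+x=1$, and let $\beta$ be an irrational real number. For $N\ge 1$ let $$\mu_N=\frac1N\sum_{i=0}^{N-1}\delta_{\beta H(i)\bmod 1}$$ be the empirical distribution of the numbers $\beta H(i) \bmod 1$ on the circle $\mathbb{R}/\mathbb{Z}$, where $\delta_x$ denotes the Dirac measure at $x$. Then: - If $\beta\in\mathbb{Q}[\alpha]$, then $\mu_N$ converges weakly, as $N\to\infty$, to a probability measure on $\mathbb{R}/\mathbb{Z}$ that is absolutely continuous with respect to Lebesgue measure. - If $\beta\notin\mathbb{Q}[\alpha]$, then $\mu_N$ converges weakly, as $N\to\infty$, to the uniform (Lebesgue) probability measure on $\mathbb{R}/\mathbb{Z}$. -/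

import Mathlib

open MeasureTheory Filter Topology

noncomputable section

/-- Hofstadter's `H` sequence, computed together with the bound `H n ≤ n` which makes the nested
recursion `H (n + 1) = n + 1 - H (H (H n))`, `H 0 = 0` well founded. Because of the bound the
subtraction of natural numbers never truncates. -/
def hofstadterAux : (n : ℕ) → {m : ℕ // m ≤ n}
  | 0 => ⟨0, le_rfl⟩
  | n + 1 =>
    let a := hofstadterAux n
    let b := hofstadterAux a.1
    let c := hofstadterAux b.1
    ⟨n + 1 - c.1, Nat.sub_le _ _⟩
termination_by n => n
decreasing_by
  · exact Nat.lt_succ_self n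
  · exact Nat.lt_succ_of_le a.2
  · exact Nat.lt_succ_of_le (b.2.trans a.2)

/-- Hofstadter's `H` sequence: `H 1 = 1` and `H n = n - H (H (H (n - 1)))` for `n > 1`, extended
by `H 0 = 0`, which is consistent with the recursion. -/
def hofstadterH (n : ℕ) : ℕ := (hofstadterAux n).1

theorem hofstadterH_le (n : ℕ) : hofstadterH n ≤ n := (hofstadterAux n).2

theorem hofstadterH_zero : hofstadterH 0 = 0 := by
  unfold hofstadterH
  rw [hofstadterAux]

theorem hofstadterH_succ (n : ℕ) :
    hofstadterH (n + 1) = n + 1 - hofstadterH (hofstadterH (hofstadterH n)) := by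
  unfold hofstadterH
  rw [hofstadterAux]

theorem hofstadterH_one : hofstadterH 1 = 1 := by
  simp [hofstadterH_succ 0, hofstadterH_zero]

/-- The defining recursion, as an identity between integers. -/
theorem hofstadterH_rec (n : ℕ) (hn : 1 < n) :
    (hofstadterH n : ℤ) = n - hofstadterH (hofstadterH (hofstadterH (n - 1))) := by
  obtain ⟨k, rfl⟩ : ∃ k, n = k + 1 := ⟨n - 1, by omega⟩
  have h1 := hofstadterH_le k
  have h2 := hofstadterH_le (hofstadterH k)
  have h3 := hofstadterH_le (hofstadterH (hofstadterH k))
  rw [hofstadterH_succ, Nat.add_sub_cancel]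
  omega

/-- The measure `μ_N = (1 / N) * ∑_{i = 0}^{N - 1} δ (a i)` on the circle `ℝ / ℤ`. -/
def empiricalMeasure (a : ℕ → UnitAddCircle) (N : ℕ) : Measure UnitAddCircle :=
  (N : ENNReal)⁻¹ • ∑ i ∈ Finset.range N, Measure.dirac (a i)

instance empiricalMeasure_isProbabilityMeasure (a : ℕ → UnitAddCircle) (N : ℕ) [NeZero N] :
    IsProbabilityMeasure (empiricalMeasure a N) := by
  constructor
  have h0 : (N : ENNReal) ≠ 0 := by exact_mod_cast NeZero.ne N
  simp [empiricalMeasure, ENNReal.inv_mul_cancel h0 (ENNReal.natCast_ne_top N)]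

/-- `empiricalMeasure a (N + 1)` as a bundled probability measure. -/
def empiricalProb (a : ℕ → UnitAddCircle) (N : ℕ) : ProbabilityMeasure UnitAddCircle :=
  ⟨empiricalMeasure a (N + 1), inferInstance⟩

/-- The distribution of the points `a 0, a 1, a 2, …` of the circle converges to the probability
measure `μ`: the empirical measures `μ_1, μ_2, …` converge weakly to `μ`. -/
def DistributionTendsto (a : ℕ → UnitAddCircle) (μ : ProbabilityMeasure UnitAddCircle) : Prop :=
  Tendsto (empiricalProb a) atTop (𝓝 μ)

/-- The uniform distribution on the circle `ℝ / ℤ` (Lebesgue measure, of total mass one). -/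
def uniformCircle : ProbabilityMeasure UnitAddCircle :=
  ⟨volume, ⟨UnitAddCircle.measure_univ⟩⟩

end

/-!
The argument is elementary and rests on the numeration system whose base is Narayana's sequence
`a (n + 3) = a (n + 2) + a n`, in which `H` shifts digits: `H (a (n + 3) + j) = a (n + 2) + H j` for
`j ≤ a (n + 1)` (`hofstadterH_narayana_add`).

*Fourier averages.* By the digit shift, the sums `S n` of `exp (2πi γ H i)` over `i < a n` satisfy a
recurrence `S (n + 4) = S (n + 3) + z n S (n + 1)` with phases `z n = exp (2πi γ a (n + 2))`. After
the normalization by `α ^ n` its right side is a convex combination of two terms, one of them rotated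
by `z n`. If the normalized sums do not tend to zero, strict convexity of the disc forces `z n → 1`
(`tendsto_zero_of_not_tendsto_one`). In that case the signed distances of `γ a n` to the nearest
integers eventually satisfy the integer recurrence exactly and tend to zero, so they lie in its
contracting plane. This means that `γ ∈ ℚ[α]` and that `z n → 1` exponentially fast
(`mem_adjoin_and_summable_of_tendsto_one`), so the normalized sums converge. Hence all exponential
averages along `H` converge, to zero unless `γ ∈ ℚ[α]` (`exists_tendsto_exp_mean`). This settles the
case `β ∉ ℚ[α]` by Weyl's criterion. In the case `β ∈ ℚ[α]` it gives a limit measure, by compactness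
of the space of probability measures on the circle.

*Absolute continuity.* Let `β ∈ ℚ[α]` be irrational. The discrepancies `H n - α n` and
`H (H n) - α² n` are bounded, and up to integers a multiple of `β H n` is a nonconstant linear
function of them. So `β H n` lies in an arc of radius `r` only if the discrepancy vector lies in one
of `O(1 / r)` squares of side `O(r)`. Two indices with discrepancy vectors in a common square differ
by some `m` for which `m α` and `m α²` are both within `O(r)` of integers. As the norm form of `ℤ[α]`
takes nonzero integer values, this is possible only for `|m|` at least of order `r⁻²`
(`one_le_mul_of_abs_sub_le`). Thus arcs of radius `r` are visited with density `O(r)`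
(`exists_card_visits_le`), and a measure with this bound on all arcs is dominated by a multiple of the
one-dimensional Hausdorff measure (`absolutelyContinuous_of_measure_ball_le`).
-/

/-! ### Narayana's cows and the top-digit recursion of `H` -/

/-- Narayana's cows sequence `1, 1, 1, 2, 3, 4, 6, 9, …`, the base of the numeration system in
which `H` is a digit shift. -/
def narayana : ℕ → ℕ
  | 0 => 1
  | 1 => 1
  | 2 => 1
  | n + 3 => narayana (n + 2) + narayana n

theorem narayana_add_three (n : ℕ) : narayana (n + 3) = narayana (n + 2) + narayana n := rfl

theorem narayana_pos : ∀ n, 0 < narayana n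
  | 0 => Nat.one_pos
  | 1 => Nat.one_pos
  | 2 => Nat.one_pos
  | n + 3 => by
    rw [narayana_add_three]
    exact Nat.add_pos_left (narayana_pos _) _

theorem narayana_monotone : Monotone narayana := by
  refine monotone_nat_of_le_succ fun n => ?_
  match n with
  | 0 => exact le_rfl
  | 1 => exact le_rfl
  | n + 2 => rw [narayana_add_three]; exact Nat.le_add_right _ _

theorem lt_narayana_add_three (n : ℕ) : n < narayana (n + 3) := by
  induction n with
  | zero => exact narayana_pos _
  | succ n ih =>
    have := narayana_pos (n + 1)
    have h : narayana (n + 1 + 3) = narayana (n + 3) + narayana (n + 1) := rfl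
    omega

/-- Splitting off the top digit: the remainder `j` is small enough for `narayana (n + 3) + j` to stay
below the next base element `narayana (n + 4)`. -/
theorem exists_eq_narayana_add {m : ℕ} (hm : 2 ≤ m) :
    ∃ n j, m = narayana (n + 3) + j ∧ j < narayana (n + 1) := by
  have hex : ∃ n, m < narayana (n + 3) := ⟨m, lt_narayana_add_three m⟩
  classical
  have h0 : Nat.find hex ≠ 0 := by
    intro h
    have := Nat.find_spec hex
    rw [h] at this
    have h3 : narayana (0 + 3) = 2 := rfl
    omega
  obtain ⟨n, hn⟩ := Nat.exists_eq_succ_of_ne_zero h0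
  have h1 := Nat.find_spec hex
  have h2 := Nat.find_min hex (m := n) (by omega)
  rw [hn, show n.succ + 3 = (n + 1) + 3 from rfl, narayana_add_three,
    show n + 1 + 2 = n + 3 from rfl] at h1
  exact ⟨n, m - narayana (n + 3), by omega, by omega⟩

theorem hofstadterH_succ_eq (n : ℕ) :
    hofstadterH (n + 1) = hofstadterH n ∨ hofstadterH (n + 1) = hofstadterH n + 1 := by
  induction n using Nat.strong_induction_on with
  | _ n ih =>
    match n with
    | 0 => right; rw [hofstadterH_one, hofstadterH_zero]
    | n + 1 =>
      have key : ∀ x y, x ≤ n → (y = x ∨ y = x + 1) →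
          hofstadterH y = hofstadterH x ∨ hofstadterH y = hofstadterH x + 1 := by
        rintro x y hx (rfl | rfl)
        · exact Or.inl rfl
        · exact ih x (by omega)
      have l1 := hofstadterH_le n
      have l2 := hofstadterH_le (hofstadterH n)
      have l3 := hofstadterH_le (hofstadterH (hofstadterH n))
      have h1 := ih n (by omega)
      have h2 := key _ _ l1 h1
      have h3 := key _ _ (l2.trans l1) h2
      have e1 := hofstadterH_succ (n + 1)
      have e2 := hofstadterH_succ n
      omega

theorem hofstadterH_monotone : Monotone hofstadterH :=
  monotone_nat_of_le_succ fun n => by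
    rcases hofstadterH_succ_eq n with h | h <;> omega

theorem hofstadterH_small : hofstadterH 2 = 1 ∧ hofstadterH 3 = 2 ∧ hofstadterH 4 = 3 ∧
    hofstadterH 5 = 4 ∧ hofstadterH 6 = 4 := by
  have h0 := hofstadterH_zero
  have h1 := hofstadterH_one
  have h2 : hofstadterH 2 = 1 := by rw [hofstadterH_succ 1, h1, h1, h1]
  have h3 : hofstadterH 3 = 2 := by rw [hofstadterH_succ 2, h2, h1, h1]
  have h4 : hofstadterH 4 = 3 := by rw [hofstadterH_succ 3, h3, h2, h1]
  have h5 : hofstadterH 5 = 4 := by rw [hofstadterH_succ 4, h4, h3, h2]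
  have h6 : hofstadterH 6 = 4 := by rw [hofstadterH_succ 5, h5, h4, h3]
  exact ⟨h2, h3, h4, h5, h6⟩

/-- `H` shifts digits: removing the top digit of `m = narayana (n + 3) + j` lowers `H m` by the
preceding base element. The boundary case `j = narayana (n + 1)`, which is not a normal form, is
included because `H j` can reach the boundary when `j` does not. -/
theorem hofstadterH_narayana_add (n : ℕ) : ∀ j ≤ narayana (n + 1),
    hofstadterH (narayana (n + 3) + j) = narayana (n + 2) + hofstadterH j := by
  induction n using Nat.strong_induction_on with
  | _ n ih =>
    obtain ⟨s2, s3, s4, s5, s6⟩ := hofstadterH_small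
    have h0 := hofstadterH_zero
    have h1 := hofstadterH_one
    match n with
    | 0 =>
      have a3 : narayana (0 + 3) = 2 := rfl
      have a2 : narayana (0 + 2) = 1 := rfl
      have a1 : narayana (0 + 1) = 1 := rfl
      rw [a3, a2, a1]
      intro j hj
      interval_cases j <;> simp_all
    | 1 =>
      have a3 : narayana (1 + 3) = 3 := rfl
      have a2 : narayana (1 + 2) = 2 := rfl
      have a1 : narayana (1 + 1) = 1 := rfl
      rw [a3, a2, a1]
      intro j hj
      interval_cases j <;> simp_all
    | 2 =>
      have a3 : narayana (2 + 3) = 4 := rfl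
      have a2 : narayana (2 + 2) = 3 := rfl
      have a1 : narayana (2 + 1) = 2 := rfl
      rw [a3, a2, a1]
      intro j hj
      interval_cases j <;> simp_all
    | n + 3 =>
      have r6 : narayana (n + 6) = narayana (n + 5) + narayana (n + 3) := rfl
      have r5 : narayana (n + 5) = narayana (n + 4) + narayana (n + 2) := rfl
      have H4 : hofstadterH (narayana (n + 4)) = narayana (n + 3) := by
        simpa [h0] using ih (n + 1) (by omega) 0 (Nat.zero_le _)
      have H3 : hofstadterH (narayana (n + 3)) = narayana (n + 2) := by
        simpa [h0] using ih n (by omega) 0 (Nat.zero_le _)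
      change ∀ j ≤ narayana (n + 4),
        hofstadterH (narayana (n + 6) + j) = narayana (n + 5) + hofstadterH j
      intro j
      induction j with
      | zero =>
        intro _
        have e : hofstadterH (narayana (n + 5) + narayana (n + 3)) =
          narayana (n + 4) + hofstadterH (narayana (n + 3)) := ih (n + 2) (by omega) _ le_rfl
        simp only [h0, r6, add_zero]
        omega
      | succ j ihj =>
        intro hj
        have b1 : hofstadterH j ≤ narayana (n + 3) := H4 ▸ hofstadterH_monotone (by omega)
        have b2 : hofstadterH (hofstadterH j) ≤ narayana (n + 2) := H3 ▸ hofstadterH_monotone b1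
        have l1 := hofstadterH_le j
        have l2 := hofstadterH_le (hofstadterH j)
        have l3 := hofstadterH_le (hofstadterH (hofstadterH j))
        have e1 := ihj (by omega)
        have e2 : hofstadterH (narayana (n + 5) + hofstadterH j) =
          narayana (n + 4) + hofstadterH (hofstadterH j) := ih (n + 2) (by omega) _ b1
        have e3 : hofstadterH (narayana (n + 4) + hofstadterH (hofstadterH j)) =
          narayana (n + 3) + hofstadterH (hofstadterH (hofstadterH j)) := ih (n + 1) (by omega) _ b2
        have e := hofstadterH_succ (narayana (n + 6) + j)
        rw [e1, e2, e3] at e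
        have e' := hofstadterH_succ j
        rw [← Nat.add_assoc, e, e']
        omega

/-! ### The contracting directions of the recurrence `x³ = x² + 1` -/

section Alpha

variable {α : ℝ}

theorem alpha_pos (hα : α ^ 3 + α = 1) : 0 < α := by
  by_contra h
  have : α ^ 3 ≤ 0 := by
    have := mul_nonneg (sq_nonneg α) (neg_nonneg.2 (not_lt.1 h))
    nlinarith
  linarith [not_lt.1 h]

theorem alpha_lt_one (hα : α ^ 3 + α = 1) : α < 1 := by
  have := pow_pos (alpha_pos hα) 3
  linarith

/-- Sequences with `ε (n + 2) + α² ε (n + 1) + α ε n = 0` decay like `√α ^ n`, because the positive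
definite form `y² + α² x y + α x²` at `(x, y) = (ε n, ε (n + 1))` is multiplied by `α` at each
step. -/
theorem exists_abs_le_sqrt_pow (hα : α ^ 3 + α = 1) {ε : ℕ → ℝ}
    (hε : ∀ n, ε (n + 2) + α ^ 2 * ε (n + 1) + α * ε n = 0) :
    ∃ C, 0 ≤ C ∧ ∀ n, |ε n| ≤ C * √α ^ n := by
  have h0 := alpha_pos hα
  have h1 := alpha_lt_one hα
  set Q : ℕ → ℝ := fun n => ε (n + 1) ^ 2 + α ^ 2 * ε (n + 1) * ε n + α * ε n ^ 2 with hQ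
  have hstep : ∀ n, Q (n + 1) = α * Q n := fun n => by
    have : ε (n + 2) = -(α ^ 2 * ε (n + 1) + α * ε n) := by linarith [hε n]
    simp only [hQ, show n + 1 + 1 = n + 2 from rfl, this]
    ring
  have hQn : ∀ n, Q n = Q 0 * α ^ n := fun n => by
    induction n with
    | zero => simp
    | succ n ih => rw [hstep, ih]; ring
  have hlow : ∀ n, α / 2 * ε n ^ 2 ≤ Q n := fun n => by
    have hα3 : α ^ 3 ≤ 1 := by linarith
    have : 0 ≤ (ε (n + 1) + α ^ 2 / 2 * ε n) ^ 2 := sq_nonneg _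
    have h2 : α ^ 4 ≤ α := by nlinarith
    have h3 : α ^ 4 * ε n ^ 2 ≤ α * ε n ^ 2 := mul_le_mul_of_nonneg_right h2 (sq_nonneg _)
    have h4 : 0 ≤ α * ε n ^ 2 := by positivity
    simp only [hQ]
    nlinarith
  have hQ0 : 0 ≤ Q 0 := le_trans (by positivity) (hlow 0)
  refine ⟨√(2 / α * Q 0), Real.sqrt_nonneg _, fun n => ?_⟩
  have h5 : ε n ^ 2 ≤ 2 / α * Q 0 * α ^ n := by
    have := hlow n
    rw [hQn] at this
    have h6 : ε n ^ 2 = 2 / α * (α / 2 * ε n ^ 2) := by field_simp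
    rw [h6, mul_assoc]
    exact mul_le_mul_of_nonneg_left this (by positivity)
  apply abs_le_of_sq_le_sq' _ (by positivity) |> abs_le.2
  rw [mul_pow, Real.sq_sqrt (by positivity), ← pow_mul, mul_comm n 2, pow_mul,
    Real.sq_sqrt h0.le]
  exact h5

theorem sqrt_alpha_lt_one (hα : α ^ 3 + α = 1) : √α < 1 := by
  rw [Real.sqrt_lt' one_pos, one_pow]
  exact alpha_lt_one hα

theorem narayana_sub_rec (hα : α ^ 3 + α = 1) (n : ℕ) :
    ((narayana (n + 2) : ℝ) - α * narayana (n + 3)) +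
      α ^ 2 * (narayana (n + 1) - α * narayana (n + 2)) +
      α * (narayana n - α * narayana (n + 1)) = 0 := by
  cases n with
  | zero => simp [narayana]; linear_combination -hα
  | succ n =>
    have r4 : (narayana (n + 4) : ℝ) = narayana (n + 3) + narayana (n + 1) := by
      exact_mod_cast narayana_add_three (n + 1)
    simp only [show n + 1 + 2 = n + 3 from rfl, show n + 1 + 3 = n + 4 from rfl,
      show n + 1 + 1 = n + 2 from rfl, r4]
    linear_combination -(narayana (n + 3) : ℝ) * hα

/-- The discrepancy `H n - α n` is bounded: it is the sum of the exponentially small discrepancies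
of the digits of `n`. -/
theorem exists_abs_hofstadterH_sub_le (hα : α ^ 3 + α = 1) :
    ∃ R, 0 ≤ R ∧ ∀ n, |(hofstadterH n : ℝ) - α * n| ≤ R := by
  obtain ⟨C, hC, hdec⟩ := exists_abs_le_sqrt_pow hα
    (ε := fun n => (narayana n : ℝ) - α * narayana (n + 1)) (narayana_sub_rec hα)
  have hs := summable_geometric_of_lt_one (Real.sqrt_nonneg α) (sqrt_alpha_lt_one hα)
  have hs' : Summable fun i => C * √α ^ i := hs.mul_left C
  have h0 := alpha_pos hα
  have h1 := alpha_lt_one hα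
  have key : ∀ n, ∀ m < narayana (n + 3),
      |(hofstadterH m : ℝ) - α * m| ≤ 1 + ∑ i ∈ Finset.range (n + 2), C * √α ^ i := by
    intro n
    induction n with
    | zero =>
      intro m hm
      have hn : 0 ≤ ∑ i ∈ Finset.range 2, C * √α ^ i := Finset.sum_nonneg fun i _ => by positivity
      have a3 : narayana (0 + 3) = 2 := rfl
      rw [a3] at hm
      interval_cases m
      · rw [hofstadterH_zero]; simp only [Nat.cast_zero, mul_zero, sub_zero, abs_zero]; linarith
      · rw [hofstadterH_one, Nat.cast_one, mul_one, abs_of_pos (by linarith)]; linarith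
    | succ n ih =>
      intro m hm
      have hn : 0 ≤ C * √α ^ (n + 2) := by positivity
      rw [show n + 1 + 2 = n + 2 + 1 from rfl, Finset.sum_range_succ]
      rcases lt_or_ge m (narayana (n + 3)) with h | h
      · linarith [ih m h]
      · have r4 : narayana (n + 1 + 3) = narayana (n + 3) + narayana (n + 1) := rfl
        obtain ⟨j, rfl⟩ := Nat.exists_eq_add_of_le h
        have hj : j < narayana (n + 1) := by omega
        rw [hofstadterH_narayana_add n j hj.le]
        have h2 := ih j (hj.trans_le (narayana_monotone (by omega)))
        have h3 : |(narayana (n + 2) : ℝ) - α * narayana (n + 3)| ≤ _ := hdec (n + 2)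
        push_cast
        rw [show ((narayana (n + 2) : ℝ) + hofstadterH j) - α * (narayana (n + 3) + j) =
          (narayana (n + 2) - α * narayana (n + 3)) + (hofstadterH j - α * j) by ring]
        exact (abs_add_le _ _).trans (by linarith)
  refine ⟨1 + ∑' i, C * √α ^ i, by positivity, fun n => ?_⟩
  exact (key n n (lt_narayana_add_three n)).trans
    (by gcongr; exact hs'.sum_le_tsum _ fun i _ => by positivity)

end Alpha

/-! ### Convergence for the perturbed recurrence -/

theorem tendsto_zero_of_le_mul_add {y d : ℕ → ℝ} {r : ℝ} (hr0 : 0 ≤ r) (hr1 : r < 1)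
    (hy : ∀ n, 0 ≤ y n) (hyd : ∀ n, y (n + 1) ≤ r * y n + d n) (hd : Tendsto d atTop (𝓝 0)) :
    Tendsto y atTop (𝓝 0) := by
  rw [Metric.tendsto_atTop]
  intro ε hε
  obtain ⟨n₀, hn₀⟩ := eventually_atTop.1
    (hd.eventually (gt_mem_nhds (show (0 : ℝ) < (1 - r) * (ε / 2) by nlinarith)))
  have hk : ∀ k, y (n₀ + k) ≤ r ^ k * y n₀ + ε / 2 := fun k => by
    induction k with
    | zero => simp; linarith
    | succ k ih =>
      have h1 := hyd (n₀ + k)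
      have h2 := hn₀ (n₀ + k) (by omega)
      have h3 := mul_le_mul_of_nonneg_left ih hr0
      rw [← add_assoc, pow_succ]
      nlinarith
  have hlim : Tendsto (fun k => r ^ k * y n₀) atTop (𝓝 0) := by
    simpa using (tendsto_pow_atTop_nhds_zero_of_lt_one hr0 hr1).mul_const (y n₀)
  obtain ⟨k₀, hk₀⟩ := eventually_atTop.1 (hlim.eventually (gt_mem_nhds (half_pos hε)))
  refine ⟨n₀ + k₀, fun n hn => ?_⟩
  obtain ⟨k, rfl⟩ := Nat.exists_eq_add_of_le hn
  have h1 := hk (k₀ + k)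
  have h2 := hk₀ (k₀ + k) (by omega)
  rw [Real.dist_eq, sub_zero, abs_of_nonneg (hy _), add_assoc]
  linarith

/-- If `2 q < 1`, the map sending a sequence `x` to `x (n + 2) + q x (n + 1) + q x n` reflects
convergence. -/
theorem tendsto_of_tendsto_add_smul {E : Type*} [NormedAddCommGroup E] [NormedSpace ℝ E]
    {x : ℕ → E} {q : ℝ} {v : E} (hq0 : 0 ≤ q) (hq1 : q < 1 / 2)
    (h : Tendsto (fun n => x (n + 2) + q • x (n + 1) + q • x n) atTop (𝓝 v)) :
    Tendsto x atTop (𝓝 ((1 + 2 * q)⁻¹ • v)) := by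
  set l := (1 + 2 * q)⁻¹ • v with hl
  have hv : v = l + q • l + q • l := by
    have h1 : (1 + 2 * q) • l = v := by rw [hl, smul_inv_smul₀ (by positivity)]
    rw [← h1]; module
  set w : ℕ → E := fun n => x n - l with hw
  have hd : Tendsto (fun n => ‖w (n + 2) + q • w (n + 1) + q • w n‖) atTop (𝓝 0) := by
    have h2 := (h.sub_const v).norm
    rw [sub_self, norm_zero] at h2
    refine h2.congr fun n => ?_
    congr 1
    rw [hv]
    simp only [hw, smul_sub]
    abel
  have hy : Tendsto (fun n => ‖w (n + 1)‖ + 1 / 2 * ‖w n‖) atTop (𝓝 0) := by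
    refine tendsto_zero_of_le_mul_add (r := 1 / 2 + q) (by linarith) (by linarith)
      (fun n => by positivity) (fun n => ?_) hd
    have h3 : ‖w (n + 2)‖ ≤ ‖w (n + 2) + q • w (n + 1) + q • w n‖ + q * ‖w (n + 1)‖
        + q * ‖w n‖ := by
      calc ‖w (n + 2)‖ = ‖(w (n + 2) + q • w (n + 1) + q • w n) - q • w (n + 1) - q • w n‖ := by
            congr 1; abel
        _ ≤ ‖w (n + 2) + q • w (n + 1) + q • w n‖ + ‖q • w (n + 1)‖ + ‖q • w n‖ :=
            (norm_sub_le _ _).trans (by gcongr; exact norm_sub_le _ _)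
        _ = _ := by rw [norm_smul, norm_smul, Real.norm_of_nonneg hq0]
    have h4 : 0 ≤ (1 / 4 - q / 2) * ‖w n‖ := mul_nonneg (by linarith) (norm_nonneg _)
    rw [show n + 1 + 1 = n + 2 from rfl]
    nlinarith
  have hw0 : Tendsto (fun n => ‖w n‖) atTop (𝓝 0) := by
    rw [← tendsto_add_atTop_iff_nat 1]
    exact squeeze_zero (fun n => norm_nonneg _)
      (fun n => le_add_of_nonneg_right (by positivity)) hy
  exact tendsto_sub_nhds_zero_iff.1 (tendsto_zero_iff_norm_tendsto_zero.2 hw0)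

section Recurrence

variable {α : ℝ}

theorem alpha_cube_lt_half (hα : α ^ 3 + α = 1) : α ^ 3 < 1 / 2 := by
  have h0 := alpha_pos hα
  by_contra h
  have h1 : α ≤ 1 / 2 := by linarith
  have h2 : α ^ 3 ≤ (1 / 2) ^ 3 := by gcongr
  linarith

/-- A quantity that does not increase along `b (n + 3) = α b (n + 2) + α³ z n b n`, `|z n| = 1`,
and whose decrements measure the cancellation between the two terms. -/
noncomputable def potential (α : ℝ) (b : ℕ → ℂ) (n : ℕ) : ℝ :=
  ‖b (n + 2)‖ + α ^ 3 * ‖b (n + 1)‖ + α ^ 3 * ‖b n‖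

theorem potential_sub (hα : α ^ 3 + α = 1) (b : ℕ → ℂ) (n : ℕ) :
    potential α b n - potential α b (n + 1) =
      α * ‖b (n + 2)‖ + α ^ 3 * ‖b n‖ - ‖b (n + 3)‖ := by
  simp only [potential, show n + 1 + 2 = n + 3 from rfl, show n + 1 + 1 = n + 2 from rfl]
  linear_combination -‖b (n + 2)‖ * hα

variable {b z : ℕ → ℂ}

theorem potential_antitone (hα : α ^ 3 + α = 1) (hz : ∀ n, ‖z n‖ = 1)
    (hb : ∀ n, b (n + 3) = α * b (n + 2) + (α : ℂ) ^ 3 * (z n * b n)) :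
    Antitone (potential α b) := by
  have h0 := alpha_pos hα
  refine antitone_nat_of_succ_le fun n => ?_
  have h1 := potential_sub hα b n
  have h2 : ‖b (n + 3)‖ ≤ α * ‖b (n + 2)‖ + α ^ 3 * ‖b n‖ := by
    rw [hb]
    refine (norm_add_le _ _).trans_eq ?_
    simp [hz, abs_of_pos h0]
  linarith

/-- If the norms of the terms of `b (n + 3) = α b (n + 2) + α³ z n b n` do not decay, then they
converge to a positive limit, the two terms on the right are asymptotically equal by strict
convexity of the disc, and so `z n → 1`. -/
theorem tendsto_zero_of_not_tendsto_one (hα : α ^ 3 + α = 1) (hz : ∀ n, ‖z n‖ = 1)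
    (hb : ∀ n, b (n + 3) = α * b (n + 2) + (α : ℂ) ^ 3 * (z n * b n))
    (hz1 : ¬ Tendsto z atTop (𝓝 1)) : Tendsto b atTop (𝓝 0) := by
  have h0 := alpha_pos hα
  have h3 := alpha_cube_lt_half hα
  have hanti := potential_antitone hα hz hb
  have hW : Tendsto (potential α b) atTop (𝓝 (⨅ n, potential α b n)) :=
    tendsto_atTop_ciInf hanti ⟨0, by rintro _ ⟨n, rfl⟩; unfold potential; positivity⟩
  set l := (1 + 2 * α ^ 3)⁻¹ • (⨅ n, potential α b n) with hl
  have hT : Tendsto (fun n => ‖b n‖) atTop (𝓝 l) :=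
    tendsto_of_tendsto_add_smul (by positivity) h3 hW
  by_cases hl0 : l = 0
  · rw [hl0] at hT
    exact tendsto_zero_iff_norm_tendsto_zero.2 hT
  refine absurd ?_ hz1
  have hT2 := hT.comp (tendsto_add_atTop_nat 2)
  have hT3 := hT.comp (tendsto_add_atTop_nat 3)
  have hconv : ∀ x y : ℂ, α * α ^ 3 * ‖x - y‖ ^ 2 =
      α * ‖x‖ ^ 2 + α ^ 3 * ‖y‖ ^ 2 - ‖(α : ℂ) * x + (α : ℂ) ^ 3 * y‖ ^ 2 := fun x y => by
    have hr : (α : ℂ) ^ 3 = ((α ^ 3 : ℝ) : ℂ) := by push_cast; rfl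
    rw [hr]
    simp only [← Complex.normSq_eq_norm_sq, Complex.normSq_apply, Complex.sub_re, Complex.sub_im,
      Complex.add_re, Complex.add_im, Complex.mul_re, Complex.mul_im, Complex.ofReal_re,
      Complex.ofReal_im]
    have h1 : α ^ 3 = 1 - α := by linarith
    rw [h1]; ring
  have hsq : Tendsto (fun n => ‖b (n + 2) - z n * b n‖ ^ 2) atTop (𝓝 0) := by
    have h4 := (((hT2.pow 2).const_mul α).add ((hT.pow 2).const_mul (α ^ 3))).sub (hT3.pow 2)
    have h5 : α * l ^ 2 + α ^ 3 * l ^ 2 - l ^ 2 = 0 := by linear_combination l ^ 2 * hα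
    rw [h5] at h4
    have h6 := h4.const_mul (α * α ^ 3)⁻¹
    rw [mul_zero] at h6
    refine h6.congr fun n => ?_
    have h7 := hconv (b (n + 2)) (z n * b n)
    rw [← hb, norm_mul, hz, one_mul] at h7
    simp only [Function.comp]
    rw [← h7, inv_mul_cancel_left₀ (by positivity)]
  have hdiff : Tendsto (fun n => b (n + 2) - z n * b n) atTop (𝓝 0) := by
    rw [tendsto_zero_iff_norm_tendsto_zero]
    have := hsq.sqrt
    simpa using this
  have hinc : Tendsto (fun n => b (n + 3) - b (n + 2)) atTop (𝓝 0) := by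
    have := hdiff.const_mul (-(α : ℂ) ^ 3)
    rw [mul_zero] at this
    refine this.congr fun n => ?_
    have hα' : (α : ℂ) ^ 3 + α = 1 := by exact_mod_cast hα
    rw [hb]
    linear_combination -b (n + 2) * hα'
  have hinc' : Tendsto (fun n => b (n + 1) - b n) atTop (𝓝 0) := by
    rw [← tendsto_add_atTop_iff_nat 2]
    exact hinc
  have hzb : Tendsto (fun n => (z n - 1) * b n) atTop (𝓝 0) := by
    have := (((hinc'.comp (tendsto_add_atTop_nat 1)).add hinc').sub hdiff)
    rw [add_zero, sub_zero] at this
    refine this.congr fun n => ?_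
    simp only [Function.comp]
    ring
  have hlast : Tendsto (fun n => ‖(z n - 1) * b n‖ / ‖b n‖) atTop (𝓝 0) := by
    have := hzb.norm.div hT hl0
    rwa [norm_zero, zero_div] at this
  rw [← tendsto_sub_nhds_zero_iff, tendsto_zero_iff_norm_tendsto_zero]
  refine hlast.congr' ?_
  filter_upwards [hT.eventually_ne hl0] with n hn
  rw [norm_mul, mul_div_cancel_right₀ _ hn]

theorem exists_tendsto_of_summable (hα : α ^ 3 + α = 1) (hz : ∀ n, ‖z n‖ = 1)
    (hb : ∀ n, b (n + 3) = α * b (n + 2) + (α : ℂ) ^ 3 * (z n * b n))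
    (hz1 : Summable fun n => ‖z n - 1‖) : ∃ l, Tendsto b atTop (𝓝 l) := by
  have h0 := alpha_pos hα
  have h3 := alpha_cube_lt_half hα
  have hbd : ∀ n, α ^ 3 * ‖b n‖ ≤ potential α b 0 := fun n =>
    le_trans (by unfold potential; linarith [norm_nonneg (b (n + 2)),
      show 0 ≤ α ^ 3 * ‖b (n + 1)‖ by positivity]) (potential_antitone hα hz hb (Nat.zero_le n))
  set V : ℕ → ℂ := fun n => b (n + 2) + (α ^ 3 : ℝ) • b (n + 1) + (α ^ 3 : ℝ) • b n with hV
  have hVd : ∀ n, V (n + 1) - V n = (α : ℂ) ^ 3 * ((z n - 1) * b n) := fun n => by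
    have hα' : (α : ℂ) ^ 3 + α = 1 := by exact_mod_cast hα
    simp only [hV, show n + 1 + 2 = n + 3 from rfl, show n + 1 + 1 = n + 2 from rfl, hb,
      Complex.real_smul, Complex.ofReal_pow]
    linear_combination b (n + 2) * hα'
  have hVs : Summable fun n => V (n + 1) - V n := by
    refine Summable.of_norm_bounded (hz1.mul_left (potential α b 0)) fun n => ?_
    rw [hVd, norm_mul, norm_mul, norm_pow, Complex.norm_real, Real.norm_of_nonneg h0.le]
    calc α ^ 3 * (‖z n - 1‖ * ‖b n‖) = (α ^ 3 * ‖b n‖) * ‖z n - 1‖ := by ring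
      _ ≤ _ := by gcongr; exact hbd n
  have hVt : Tendsto V atTop (𝓝 (V 0 + ∑' n, (V (n + 1) - V n))) := by
    have := hVs.hasSum.tendsto_sum_nat.const_add (V 0)
    refine this.congr fun n => ?_
    rw [Finset.sum_range_sub]
    ring
  exact ⟨_, tendsto_of_tendsto_add_smul (by positivity) h3 hVt⟩

end Recurrence

/-! ### Averages of digit-multiplicative functions -/

/-- If `f` is multiplicative with respect to removing the top digit, with factors `z n`, then the
convergence of its averages along base elements to `c` implies that of all its averages, provided
`c (z n - 1) → 0`. -/
theorem tendsto_mean_of_narayana {f z : ℕ → ℂ} {c : ℂ} (hz : ∀ n, ‖z n‖ = 1)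
    (hfz : ∀ n, ∀ j < narayana (n + 1), f (narayana (n + 3) + j) = z n * f j)
    (hS : Tendsto (fun n => (∑ i ∈ Finset.range (narayana n), f i) / narayana n) atTop (𝓝 c))
    (hzc : Tendsto (fun n => c * (z n - 1)) atTop (𝓝 0)) :
    Tendsto (fun N : ℕ => (∑ i ∈ Finset.range N, f i) / N) atTop (𝓝 c) := by
  set F : ℕ → ℂ := fun N => ∑ i ∈ Finset.range N, f i with hF
  have hFadd : ∀ n, ∀ j ≤ narayana (n + 1),
      F (narayana (n + 3) + j) = F (narayana (n + 3)) + z n * F j := fun n j hj => by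
    simp only [hF]
    rw [Finset.sum_range_add, Finset.mul_sum]
    congr 1
    exact Finset.sum_congr rfl fun i hi => hfz n i ((Finset.mem_range.1 hi).trans_le hj)
  rw [Metric.tendsto_atTop]
  intro ε hε
  have hε4 : 0 < ε / 4 := by positivity
  obtain ⟨n₁, hn₁⟩ := Metric.tendsto_atTop.1 hS (ε / 4) hε4
  obtain ⟨n₂, hn₂⟩ := Metric.tendsto_atTop.1 hzc (ε / 4) hε4
  set n₀ := max n₁ n₂ with hn₀
  -- errors in the finitely many initial blocks are absorbed in a constant
  obtain ⟨K, hK⟩ : ∃ K : ℝ, ∀ N ≤ narayana (n₀ + 3), ‖F N - c * N‖ ≤ K :=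
    ⟨∑ N ∈ Finset.range (narayana (n₀ + 3) + 1), ‖F N - c * N‖, fun N hN =>
      Finset.single_le_sum (f := fun N : ℕ => ‖F N - c * N‖) (fun _ _ => norm_nonneg _)
        (Finset.mem_range.2 (by omega))⟩
  have hmain : ∀ N, ‖F N - c * N‖ ≤ ε / 2 * N + K := by
    intro N
    induction N using Nat.strong_induction_on with
    | _ N ih =>
      have hN0 : (0 : ℝ) ≤ ε / 2 * N := by positivity
      rcases le_or_gt N (narayana (n₀ + 3)) with h | h
      · linarith [hK N h]
      obtain ⟨n, j, rfl, hj⟩ := exists_eq_narayana_add (m := N) (by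
        have := narayana_pos (n₀ + 3); omega)
      have hn : n₀ ≤ n := by
        by_contra hlt
        have h1 : narayana (n + 1 + 3) ≤ narayana (n₀ + 3) := narayana_monotone (by omega)
        have h2 : narayana (n + 1 + 3) = narayana (n + 3) + narayana (n + 1) := rfl
        omega
      have hjle : j ≤ narayana (n + 3) := hj.le.trans (narayana_monotone (by omega))
      have hjle' : (j : ℝ) ≤ narayana (n + 3) := by exact_mod_cast hjle
      have ha : (0 : ℝ) < narayana (n + 3) := by exact_mod_cast narayana_pos _
      have e1 := hn₁ (n + 3) (by omega)
      have e2 := hn₂ n (by omega)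
      have e3 := ih j (by have := narayana_pos (n + 3); omega)
      rw [dist_zero_right] at e2
      have e1' : ‖F (narayana (n + 3)) - c * narayana (n + 3)‖ ≤ ε / 4 * narayana (n + 3) := by
        have hac : (narayana (n + 3) : ℂ) ≠ 0 := by exact_mod_cast ha.ne'
        have : F (narayana (n + 3)) - c * narayana (n + 3) =
          (F (narayana (n + 3)) / narayana (n + 3) - c) * narayana (n + 3) := by field_simp
        rw [this, norm_mul, Complex.norm_natCast]
        gcongr
        rw [← dist_eq_norm]
        exact e1.le
      have hsplit : F (narayana (n + 3) + j) - c * (narayana (n + 3) + j : ℕ) =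
          (F (narayana (n + 3)) - c * narayana (n + 3)) + z n * (F j - c * j) +
            c * (z n - 1) * j := by
        rw [hFadd n j hj.le]; push_cast; ring
      rw [hsplit]
      refine (norm_add₃_le).trans ?_
      rw [norm_mul (z n), hz, one_mul, norm_mul (c * (z n - 1)), Complex.norm_natCast]
      have e4 : ‖c * (z n - 1)‖ * j ≤ ε / 4 * narayana (n + 3) := by gcongr
      push_cast
      linarith
  obtain ⟨M, hM⟩ := exists_nat_gt (2 * K / ε)
  refine ⟨M + 1, fun N hN => ?_⟩
  have hNM : (M : ℝ) + 1 ≤ N := by exact_mod_cast hN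
  have hN0 : (0 : ℝ) < N := by linarith [Nat.cast_nonneg (α := ℝ) M]
  have hN0' : (N : ℂ) ≠ 0 := by exact_mod_cast hN0.ne'
  have h1 : (∑ i ∈ Finset.range N, f i) / N - c = (F N - c * N) / N := by
    rw [sub_div, mul_div_cancel_right₀ _ hN0']
  rw [dist_eq_norm, h1, norm_div, Complex.norm_natCast, div_lt_iff₀ hN0]
  have h2 : 2 * K < ε * N := by
    rw [div_lt_iff₀ hε] at hM
    nlinarith
  linarith [hmain N]

/-! ### Exponential averages along `H` -/

section Means

variable {α : ℝ}

theorem narayana_combination_pos (hα : α ^ 3 + α = 1) (n : ℕ) :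
    0 < (narayana (n + 2) : ℝ) + α ^ 2 * narayana (n + 1) + α * narayana n := by
  have h0 := alpha_pos hα
  have h1 : (0 : ℝ) < narayana (n + 2) := by exact_mod_cast narayana_pos _
  positivity

theorem pow_mul_narayana_combination (hα : α ^ 3 + α = 1) (n : ℕ) :
    α ^ n * ((narayana (n + 2) : ℝ) + α ^ 2 * narayana (n + 1) + α * narayana n) =
      1 + α ^ 2 + α := by
  induction n with
  | zero => simp [narayana]
  | succ n ih =>
    have r3 : (narayana (n + 3) : ℝ) = narayana (n + 2) + narayana n := by
      exact_mod_cast narayana_add_three n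
    rw [show n + 1 + 2 = n + 3 from rfl, show n + 1 + 1 = n + 2 from rfl, r3, ← ih]
    linear_combination α ^ n * (narayana (n + 2) : ℝ) * hα

/-- `narayana n` grows like a constant multiple of `α⁻ⁿ`. -/
theorem exists_tendsto_pow_mul_narayana (hα : α ^ 3 + α = 1) :
    ∃ κ, κ ≠ 0 ∧ Tendsto (fun n => α ^ n * (narayana n : ℝ)) atTop (𝓝 κ) := by
  have h0 := alpha_pos hα
  refine ⟨(1 + 2 * α ^ 3)⁻¹ • (α ^ 2 * (1 + α ^ 2 + α)), ?_, ?_⟩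
  · rw [smul_eq_mul]; positivity
  · refine tendsto_of_tendsto_add_smul (by positivity) (alpha_cube_lt_half hα) ?_
    refine tendsto_const_nhds.congr fun n => ?_
    rw [← pow_mul_narayana_combination hα n, smul_eq_mul, smul_eq_mul]
    ring

theorem inv_mem_adjoin (hα : α ^ 3 + α = 1) {x : ℝ}
    (hx : x ∈ Algebra.adjoin ℚ ({α} : Set ℝ)) : x⁻¹ ∈ Algebra.adjoin ℚ ({α} : Set ℝ) := by
  have hint : IsIntegral ℚ α := by
    refine ⟨Polynomial.X ^ 3 + Polynomial.X - 1, ?_, ?_⟩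
    · monicity!
    · simp [hα]
  have hx' : IsIntegral ℚ x := adjoin_le_integralClosure hint hx
  exact Subalgebra.inv_mem_of_algebraic (A := Algebra.adjoin ℚ ({α} : Set ℝ)) (x := ⟨x, hx⟩)
    hx'.isAlgebraic

theorem norm_exp_two_pi_sub_one (t : ℝ) :
    ‖Complex.exp (2 * Real.pi * Complex.I * t) - 1‖ =
      2 * |Real.sin (Real.pi * (t - round t))| := by
  have h : Complex.exp (2 * Real.pi * Complex.I * t) =
      Complex.exp (Complex.I * ((2 * Real.pi * (t - round t) : ℝ) : ℂ)) := by
    rw [Complex.exp_eq_exp_iff_exists_int]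
    exact ⟨round t, by push_cast; ring⟩
  rw [h, Complex.norm_exp_I_mul_ofReal_sub_one, Real.norm_eq_abs, abs_mul, abs_two]
  congr 3
  ring

theorem four_mul_abs_sub_round_le (t : ℝ) :
    4 * |t - round t| ≤ ‖Complex.exp (2 * Real.pi * Complex.I * t) - 1‖ := by
  have hr := abs_sub_round t
  have hpi := Real.pi_pos
  have habs : |Real.pi * (t - round t)| = Real.pi * |t - round t| := by
    rw [abs_mul, abs_of_pos hpi]
  have := Real.mul_abs_le_abs_sin (x := Real.pi * (t - round t)) (by rw [habs]; nlinarith)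
  rw [norm_exp_two_pi_sub_one]
  rw [habs, ← mul_assoc, div_mul_cancel₀ _ hpi.ne'] at this
  linarith

theorem norm_exp_two_pi_sub_one_le (t : ℝ) :
    ‖Complex.exp (2 * Real.pi * Complex.I * t) - 1‖ ≤ 2 * Real.pi * |t - round t| := by
  rw [norm_exp_two_pi_sub_one]
  have := Real.abs_sin_le_abs (x := Real.pi * (t - round t))
  rw [abs_mul, abs_of_pos Real.pi_pos] at this
  linarith

/-- The phases `exp (2πi γ narayana n)` tend to `1` only if the distances of `γ narayana n` to the
integers eventually obey the recurrence exactly. They then lie in its contracting subspace, which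
forces `γ ∈ ℚ[α]` and exponential convergence. -/
theorem mem_adjoin_and_summable_of_tendsto_one (hα : α ^ 3 + α = 1) {γ : ℝ}
    (h : Tendsto (fun n => Complex.exp (2 * Real.pi * Complex.I * (γ * narayana (n + 2) : ℝ)))
      atTop (𝓝 1)) :
    γ ∈ Algebra.adjoin ℚ ({α} : Set ℝ) ∧
      Summable fun n => ‖Complex.exp (2 * Real.pi * Complex.I * (γ * narayana (n + 2) : ℝ)) - 1‖ := by
  have h0 := alpha_pos hα
  have h1 := alpha_lt_one hα
  set ε : ℕ → ℝ := fun n => γ * narayana (n + 2) - round (γ * narayana (n + 2)) with hε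
  have hε0 : Tendsto ε atTop (𝓝 0) := by
    refine tendsto_zero_iff_abs_tendsto_zero _ |>.2 ?_
    have h2 := (tendsto_sub_nhds_zero_iff.2 h).norm
    rw [norm_zero] at h2
    exact squeeze_zero (fun n => abs_nonneg _)
      (fun n => by
        have := four_mul_abs_sub_round_le (γ * narayana (n + 2))
        have := abs_nonneg (ε n)
        simp only [Function.comp, hε] at *
        linarith) h2
  obtain ⟨n₀, hn₀⟩ := eventually_atTop.1
    (hε0.abs.eventually (gt_mem_nhds (show |(0 : ℝ)| < 1 / 4 by norm_num)))
  have hrec : ∀ n, ε (n₀ + n + 3) = ε (n₀ + n + 2) + ε (n₀ + n) := fun n => by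
    have r : (narayana (n₀ + n + 3 + 2) : ℝ) =
        narayana (n₀ + n + 2 + 2) + narayana (n₀ + n + 2) := by
      exact_mod_cast narayana_add_three (n₀ + n + 2)
    have a1 := abs_lt.1 (hn₀ (n₀ + n + 3) (by omega))
    have a2 := abs_lt.1 (hn₀ (n₀ + n + 2) (by omega))
    have a3 := abs_lt.1 (hn₀ (n₀ + n) (by omega))
    have hk : round (γ * narayana (n₀ + n + 3 + 2)) =
        round (γ * narayana (n₀ + n + 2 + 2)) + round (γ * narayana (n₀ + n + 2)) := by
      simp only [hε] at a1 a2 a3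
      rw [← sub_eq_zero, ← Int.abs_lt_one_iff, ← Int.cast_lt (R := ℝ)]
      push_cast
      rw [r] at a1 ⊢
      rw [abs_lt]
      constructor <;> linarith
    simp only [hε]
    rw [hk, r]
    push_cast
    ring
  have hE : ∀ n, ε (n₀ + n + 2) + α ^ 2 * ε (n₀ + n + 1) + α * ε (n₀ + n) = 0 := by
    set E : ℕ → ℝ := fun n => ε (n₀ + n + 2) + α ^ 2 * ε (n₀ + n + 1) + α * ε (n₀ + n) with hEdef
    have hEs : ∀ n, E n = α * E (n + 1) := fun n => by
      simp only [hEdef, hrec, show n₀ + (n + 1) = n₀ + n + 1 from rfl]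
      linear_combination -ε (n₀ + n + 2) * hα
    have hEk : ∀ n k, E n = α ^ k * E (n + k) := fun n k => by
      induction k with
      | zero => simp
      | succ k ih => rw [ih, hEs (n + k), pow_succ, mul_assoc]; rfl
    have hE0 : Tendsto E atTop (𝓝 0) := by
      have hs : ∀ i, Tendsto (fun n => ε (n₀ + n + i)) atTop (𝓝 0) := fun i => by
        refine (hε0.comp (tendsto_add_atTop_nat (n₀ + i))).congr fun n => ?_
        simp only [Function.comp]
        congr 1; omega
      have := ((hs 2).add ((hs 1).const_mul (α ^ 2))).add ((hs 0).const_mul α)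
      simpa using this
    intro n
    have hlim : Tendsto (fun k => α ^ k * E (n + k)) atTop (𝓝 (0 * 0)) := by
      refine (tendsto_pow_atTop_nhds_zero_of_lt_one h0.le h1).mul ?_
      refine (hE0.comp (tendsto_add_atTop_nat n)).congr fun k => ?_
      simp only [Function.comp, add_comm]
    have := tendsto_nhds_unique (tendsto_const_nhds.congr fun k => hEk n k) hlim
    simpa using this
  constructor
  · have hD := narayana_combination_pos hα (n₀ + 2)
    have hE' := hE 0
    simp only [hε, add_zero] at hE'
    have hγ : γ = (round (γ * narayana (n₀ + 2 + 2)) + α ^ 2 * round (γ * narayana (n₀ + 1 + 2)) +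
        α * round (γ * narayana (n₀ + 2))) *
        ((narayana (n₀ + 2 + 2) : ℝ) + α ^ 2 * narayana (n₀ + 2 + 1) +
          α * narayana (n₀ + 2))⁻¹ := by
      rw [← div_eq_mul_inv, eq_div_iff hD.ne']
      rw [show n₀ + 1 + 2 = n₀ + 2 + 1 from rfl] at hE' ⊢
      linear_combination hE'
    have hmem : α ∈ Algebra.adjoin ℚ ({α} : Set ℝ) := Algebra.self_mem_adjoin_singleton ℚ α
    rw [hγ]
    refine mul_mem ?_ (inv_mem_adjoin hα ?_)
    · exact add_mem (add_mem (intCast_mem _ _) (mul_mem (pow_mem hmem _) (intCast_mem _ _)))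
        (mul_mem hmem (intCast_mem _ _))
    · exact add_mem (add_mem (natCast_mem _ _) (mul_mem (pow_mem hmem _) (natCast_mem _ _)))
        (mul_mem hmem (natCast_mem _ _))
  · obtain ⟨C, hC, hdec⟩ := exists_abs_le_sqrt_pow hα (ε := fun n => ε (n₀ + n)) hE
    have hs : Summable fun n => 2 * Real.pi * (C * √α ^ n) :=
      ((summable_geometric_of_lt_one (Real.sqrt_nonneg α) (sqrt_alpha_lt_one hα)).mul_left C).mul_left
        _
    rw [← summable_nat_add_iff n₀]
    refine Summable.of_nonneg_of_le (fun n => norm_nonneg _) (fun n => ?_) hs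
    refine (norm_exp_two_pi_sub_one_le _).trans ?_
    gcongr
    have := hdec n
    simp only [hε] at this
    rwa [add_comm n₀ n] at this

/-- All exponential averages along `H` converge, and only frequencies in `ℚ[α]` can have a nonzero
limit. -/
theorem exists_tendsto_exp_mean (hα : α ^ 3 + α = 1) (γ : ℝ) :
    ∃ c : ℂ, Tendsto (fun N : ℕ => (∑ i ∈ Finset.range N,
        Complex.exp (2 * Real.pi * Complex.I * (γ * hofstadterH i : ℝ))) / N) atTop (𝓝 c) ∧
      (c ≠ 0 → γ ∈ Algebra.adjoin ℚ ({α} : Set ℝ)) := by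
  have h0 := alpha_pos hα
  set f : ℕ → ℂ := fun i => Complex.exp (2 * Real.pi * Complex.I * (γ * hofstadterH i : ℝ)) with hf
  set z : ℕ → ℂ := fun n => Complex.exp (2 * Real.pi * Complex.I * (γ * narayana (n + 2) : ℝ))
    with hzdef
  have hz : ∀ n, ‖z n‖ = 1 := fun n => by
    have : (2 * Real.pi * Complex.I * (γ * narayana (n + 2) : ℝ) : ℂ) =
      ((2 * Real.pi * (γ * narayana (n + 2)) : ℝ) : ℂ) * Complex.I := by push_cast; ring
    simp only [hzdef, this, Complex.norm_exp_ofReal_mul_I]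
  have hfz : ∀ n, ∀ j < narayana (n + 1), f (narayana (n + 3) + j) = z n * f j :=
    fun n j hj => by
      simp only [hf, hzdef]
      rw [hofstadterH_narayana_add n j hj.le, ← Complex.exp_add]
      congr 1; push_cast; ring
  set S : ℕ → ℂ := fun n => ∑ i ∈ Finset.range (narayana n), f i with hSdef
  have hSrec : ∀ n, S (n + 4) = S (n + 3) + z n * S (n + 1) := fun n => by
    simp only [hSdef]
    rw [show narayana (n + 4) = narayana (n + 3) + narayana (n + 1) from rfl,
      Finset.sum_range_add, Finset.mul_sum]
    congr 1
    exact Finset.sum_congr rfl fun i hi => hfz n i (Finset.mem_range.1 hi)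
  set b : ℕ → ℂ := fun n => (α : ℂ) ^ (n + 1) * S (n + 1) with hbdef
  have hb : ∀ n, b (n + 3) = α * b (n + 2) + (α : ℂ) ^ 3 * (z n * b n) := fun n => by
    simp only [hbdef]
    rw [show n + 3 + 1 = n + 4 from rfl, show n + 2 + 1 = n + 3 from rfl, hSrec]
    ring
  have hlim : ∃ l, Tendsto b atTop (𝓝 l) ∧ (l ≠ 0 → Tendsto z atTop (𝓝 1)) := by
    by_cases hz1 : Tendsto z atTop (𝓝 1)
    · obtain ⟨l, hl⟩ := exists_tendsto_of_summable hα hz hb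
        (mem_adjoin_and_summable_of_tendsto_one hα hz1).2
      exact ⟨l, hl, fun _ => hz1⟩
    · exact ⟨0, tendsto_zero_of_not_tendsto_one hα hz hb hz1, fun h => absurd rfl h⟩
  obtain ⟨l, hl, hlz⟩ := hlim
  obtain ⟨κ, hκ0, hκ⟩ := exists_tendsto_pow_mul_narayana hα
  have hκ' : Tendsto (fun n => (α : ℂ) ^ n * narayana n) atTop (𝓝 (κ : ℂ)) := by
    have := (Complex.continuous_ofReal.tendsto κ).comp hκ
    simpa [Function.comp_def] using this
  have hSt : Tendsto (fun n => S n / narayana n) atTop (𝓝 (l / κ)) := by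
    rw [← tendsto_add_atTop_iff_nat 1]
    have := hl.div (hκ'.comp (tendsto_add_atTop_nat 1)) (by exact_mod_cast hκ0)
    refine this.congr fun n => ?_
    have hα0 : (α : ℂ) ^ (n + 1) ≠ 0 := pow_ne_zero _ (by exact_mod_cast h0.ne')
    simp only [Pi.div_apply, Function.comp, hbdef]
    rw [mul_div_mul_left _ _ hα0]
  have hzc : Tendsto (fun n => l / κ * (z n - 1)) atTop (𝓝 0) := by
    by_cases hl0 : l = 0
    · simp [hl0]
    · have := (tendsto_sub_nhds_zero_iff.2 (hlz hl0)).const_mul (l / κ)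
      rwa [mul_zero] at this
  refine ⟨l / κ, tendsto_mean_of_narayana hz hfz hSt hzc, fun hne => ?_⟩
  exact (mem_adjoin_and_summable_of_tendsto_one hα
    (hlz fun h => hne (by rw [h, zero_div]))).1

end Means

/-! ### Weak convergence on the circle -/

theorem integral_empiricalMeasure (a : ℕ → UnitAddCircle) (N : ℕ) (f : C(UnitAddCircle, ℂ)) :
    ∫ x, f x ∂(empiricalMeasure a N) = (∑ i ∈ Finset.range N, f (a i)) / N := by
  rw [empiricalMeasure, integral_smul_measure, integral_finsetSum_measure]
  · simp only [integral_dirac, ENNReal.toReal_inv, ENNReal.toReal_natCast, Complex.real_smul]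
    push_cast
    ring
  · intro i _
    exact integrable_dirac (by simp [enorm_lt_top])

/-- Weyl's criterion for a general limit measure. -/
theorem tendsto_of_tendsto_integral_fourier {ι : Type*} {L : Filter ι}
    {μs : ι → ProbabilityMeasure UnitAddCircle} {μ : ProbabilityMeasure UnitAddCircle}
    (h : ∀ k : ℤ, Tendsto (fun i => ∫ x, fourier k x ∂(μs i : Measure UnitAddCircle)) L
      (𝓝 (∫ x, fourier k x ∂(μ : Measure UnitAddCircle)))) : Tendsto μs L (𝓝 μ) := by
  rw [ProbabilityMeasure.tendsto_iff_forall_integral_rclike_tendsto ℂ]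
  have hint : ∀ (ν : ProbabilityMeasure UnitAddCircle) (f : C(UnitAddCircle, ℂ)),
      Integrable f (ν : Measure UnitAddCircle) := fun ν f =>
    f.continuous.integrable_of_hasCompactSupport (HasCompactSupport.of_compactSpace _)
  have hspan : ∀ f ∈ Submodule.span ℂ (Set.range (@fourier (1 : ℝ))),
      Tendsto (fun i => ∫ x, f x ∂(μs i : Measure UnitAddCircle)) L
        (𝓝 (∫ x, f x ∂(μ : Measure UnitAddCircle))) := by
    intro f hf
    induction hf using Submodule.span_induction with
    | mem f hf => obtain ⟨k, rfl⟩ := hf; exact h k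
    | zero => simpa using tendsto_const_nhds
    | add f g _ _ hf hg =>
      simp only [ContinuousMap.add_apply]
      simp_rw [fun ν : ProbabilityMeasure UnitAddCircle => integral_add (hint ν f) (hint ν g)]
      exact hf.add hg
    | smul c f _ hf =>
      simp only [ContinuousMap.smul_apply, integral_smul]
      exact hf.const_smul c
  intro f
  have hf : f.toContinuousMap ∈ closure
      (Submodule.span ℂ (Set.range (@fourier (1 : ℝ))) : Set C(UnitAddCircle, ℂ)) := by
    have := span_fourier_closure_eq_top (T := (1 : ℝ))
    rw [← Submodule.topologicalClosure_coe, this]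
    trivial
  rw [Metric.tendsto_nhds]
  intro ε hε
  obtain ⟨g, hg, hfg⟩ := Metric.mem_closure_iff.1 hf (ε / 3) (by positivity)
  have hclose : ∀ ν : ProbabilityMeasure UnitAddCircle,
      dist (∫ x, f x ∂(ν : Measure UnitAddCircle)) (∫ x, g x ∂(ν : Measure UnitAddCircle))
        ≤ ε / 3 := fun ν => by
    have hsub := integral_sub (hint ν f.toContinuousMap) (hint ν g)
    rw [dist_eq_norm]
    refine (congrArg norm hsub).symm.trans_le ?_
    have := norm_integral_le_of_norm_le_const (μ := (ν : Measure UnitAddCircle)) (C := ε / 3)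
      (f := fun x => f x - g x) (Eventually.of_forall fun x => by
        rw [← dist_eq_norm]
        exact (ContinuousMap.dist_apply_le_dist (f := f.toContinuousMap) (g := g) x).trans hfg.le)
    simpa using this
  filter_upwards [Metric.tendsto_nhds.1 (hspan g hg) (ε / 3) (by positivity)] with i hi
  have h1 := hclose (μs i)
  have h2 := hclose μ
  rw [dist_comm] at h2
  calc _ ≤ dist _ (∫ x, g x ∂(μs i : Measure UnitAddCircle)) +
        dist (∫ x, g x ∂(μs i : Measure UnitAddCircle)) (∫ x, g x ∂(μ : Measure UnitAddCircle)) +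
        dist (∫ x, g x ∂(μ : Measure UnitAddCircle)) _ := dist_triangle4 _ _ _ _
    _ < ε := by linarith

/-- If all exponential averages of a sequence of points converge, then the points have a limit
distribution, by compactness of the space of probability measures. -/
theorem exists_distributionTendsto {a : ℕ → UnitAddCircle} {c : ℤ → ℂ}
    (h : ∀ k : ℤ, Tendsto (fun N : ℕ => (∑ i ∈ Finset.range N, fourier k (a i)) / N) atTop
      (𝓝 (c k))) :
    ∃ μ : ProbabilityMeasure UnitAddCircle, DistributionTendsto a μ ∧
      ∀ k : ℤ, ∫ x, fourier k x ∂(μ : Measure UnitAddCircle) = c k := by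
  have hc : ∀ k : ℤ, Tendsto
      (fun N => ∫ x, fourier k x ∂(empiricalProb a N : Measure UnitAddCircle)) atTop
      (𝓝 (c k)) := fun k => by
    refine ((h k).comp (tendsto_add_atTop_nat 1)).congr fun N => ?_
    exact (integral_empiricalMeasure a (N + 1) (fourier k)).symm
  obtain ⟨μ, -, hμ⟩ := isCompact_univ.ultrafilter_le_nhds
    (Ultrafilter.map (empiricalProb a) (hyperfilter ℕ)) (by simp)
  have hμ' : Tendsto (empiricalProb a) (hyperfilter ℕ) (𝓝 μ) := hμ
  have hμc : ∀ k : ℤ, ∫ x, fourier k x ∂(μ : Measure UnitAddCircle) = c k := fun k =>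
    tendsto_nhds_unique
      ((ProbabilityMeasure.tendsto_iff_forall_integral_rclike_tendsto ℂ).1 hμ'
        (BoundedContinuousFunction.mkOfCompact (fourier k)))
      ((hc k).mono_left Nat.hyperfilter_le_atTop)
  exact ⟨μ, tendsto_of_tendsto_integral_fourier fun k => by rw [hμc]; exact hc k, hμc⟩

theorem distributionTendsto_uniformCircle {a : ℕ → UnitAddCircle}
    (h : ∀ k : ℤ, k ≠ 0 →
      Tendsto (fun N : ℕ => (∑ i ∈ Finset.range N, fourier k (a i)) / N) atTop (𝓝 0)) :
    DistributionTendsto a uniformCircle := by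
  refine tendsto_of_tendsto_integral_fourier fun k => ?_
  have hemp : ∀ N, ∫ x, fourier k x ∂(empiricalProb a N : Measure UnitAddCircle) =
      (∑ i ∈ Finset.range (N + 1), fourier k (a i)) / (N + 1 : ℕ) := fun N =>
    integral_empiricalMeasure a (N + 1) (fourier k)
  by_cases hk : k = 0
  · subst hk
    simp
  · have hvol : ∫ x, fourier k x ∂(uniformCircle : Measure UnitAddCircle) = 0 := by
      have h1 := congrFun (fourierCoeff_fourier (T := 1) k) 0
      rw [fourierCoeff, Pi.single_eq_of_ne (Ne.symm hk)] at h1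
      change ∫ x, fourier k x ∂(volume : Measure UnitAddCircle) = 0
      rw [AddCircle.volume_eq_smul_haarAddCircle, ENNReal.ofReal_one, one_smul]
      simpa using h1
    simp_rw [hvol, hemp]
    exact (h k hk).comp (tendsto_add_atTop_nat 1)

/-- A measure on the circle whose mass of balls is at most proportional to their radius is absolutely
continuous: it is dominated by the one-dimensional Hausdorff measure. -/
theorem absolutelyContinuous_of_measure_ball_le {μ : Measure UnitAddCircle} {C : ℝ} (hC : 0 < C)
    (h : ∀ x, ∀ r, 0 < r → μ (Metric.ball x r) ≤ ENNReal.ofReal (C * r)) : μ ≪ volume := by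
  set K : ENNReal := ENNReal.ofReal C with hK
  have hK0 : K ≠ 0 := by simpa [hK] using hC
  have hKt : K ≠ ⊤ := ENNReal.ofReal_ne_top
  have hle : K⁻¹ • μ ≤ μH[1] := by
    refine Measure.le_hausdorffMeasure 1 _ 1 one_pos fun s hs => ?_
    rw [ENNReal.rpow_one, Measure.smul_apply, smul_eq_mul,
      ENNReal.inv_mul_le_iff hK0 hKt]
    rcases s.eq_empty_or_nonempty with rfl | ⟨x, hx⟩
    · simp
    have hst : Metric.ediam s ≠ ⊤ := ne_top_of_le_ne_top ENNReal.one_ne_top hs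
    have hr : ∀ r ∈ Set.Ioi (Metric.diam s), μ s ≤ ENNReal.ofReal (C * r) := fun r hr =>
      (measure_mono fun y hy => Metric.mem_ball.2
        ((Metric.dist_le_diam_of_mem' hst hy hx).trans_lt hr)).trans
        (h x r (Metric.diam_nonneg.trans_lt hr))
    have hlim : Tendsto (fun r => ENNReal.ofReal (C * r)) (𝓝[>] Metric.diam s)
        (𝓝 (ENNReal.ofReal (C * Metric.diam s))) :=
      (ENNReal.continuous_ofReal.comp (continuous_const.mul continuous_id)).continuousWithinAt
    refine (ge_of_tendsto hlim (eventually_nhdsWithin_of_forall hr)).trans_eq ?_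
    rw [ENNReal.ofReal_mul hC.le, Metric.diam, ENNReal.ofReal_toReal hst]
  intro s hs
  set E : Set ℝ := ((↑) : ℝ → UnitAddCircle) ⁻¹' s ∩ Set.Ioc 0 (0 + 1) with hE
  have hE0 : volume E = 0 := by
    have := (UnitAddCircle.measurePreserving_mk 0).quasiMeasurePreserving.preimage_null hs
    rwa [Measure.restrict_apply' measurableSet_Ioc] at this
  have himg : s ⊆ ((↑) : ℝ → UnitAddCircle) '' E := by
    intro y hy
    obtain ⟨x, hx, rfl⟩ : y ∈ ((↑) : ℝ → UnitAddCircle) '' Set.Ioc 0 (0 + 1) := by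
      rw [AddCircle.coe_image_Ioc_eq]; trivial
    exact ⟨x, ⟨hy, hx⟩, rfl⟩
  have hLip : LipschitzWith 1 ((↑) : ℝ → UnitAddCircle) := by
    refine LipschitzWith.of_dist_le_mul fun x y => ?_
    rw [NNReal.coe_one, one_mul, dist_eq_norm, ← AddCircle.coe_sub, Real.dist_eq, UnitAddCircle.norm_eq]
    simpa using round_le (x - y) 0
  have hH : μH[1] s = 0 := by
    refine le_antisymm ((measure_mono himg).trans ?_) zero_le
    refine ((hLip.lipschitzOnWith (s := E)).hausdorffMeasure_image_le zero_le_one).trans ?_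
    rw [hausdorffMeasure_real, hE0, mul_zero]
  have h0 := hle s
  rw [hH, Measure.smul_apply, smul_eq_mul, nonpos_iff_eq_zero, mul_eq_zero] at h0
  exact h0.resolve_left (ENNReal.inv_ne_zero.2 hKt)

/-! ### The norm form of `ℤ[α]` and badly approximable vectors -/

/-- The norm of `x + y α + z α²` from `ℚ(α)` to `ℚ`, as the determinant of the multiplication
matrix. -/
def cubicNorm (x y z : ℤ) : ℤ :=
  x * ((x - z) ^ 2 - y * (z - y)) - y * (z * (x - z) - y ^ 2) + z * (z * (z - y) - y * (x - z))

/-- The norm form is anisotropic, by descent: modulo `2` it is the norm form of a field with eight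
elements, so a zero of it has even coordinates. -/
theorem eq_zero_of_cubicNorm_eq_zero (x y z : ℤ) (h : cubicNorm x y z = 0) :
    x = 0 ∧ y = 0 ∧ z = 0 := by
  induction hn : x.natAbs + y.natAbs + z.natAbs using Nat.strong_induction_on
    generalizing x y z with
  | _ n ih =>
    have hmod : ∀ x y z : ZMod 2,
        x * ((x - z) ^ 2 - y * (z - y)) - y * (z * (x - z) - y ^ 2) +
          z * (z * (z - y) - y * (x - z)) = 0 → x = 0 ∧ y = 0 ∧ z = 0 := by decide
    have h2 := congrArg (Int.cast : ℤ → ZMod 2) h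
    simp only [cubicNorm] at h2
    push_cast at h2
    obtain ⟨hx, hy, hz⟩ := hmod _ _ _ h2
    rw [ZMod.intCast_zmod_eq_zero_iff_dvd] at hx hy hz
    obtain ⟨x, rfl⟩ := hx
    obtain ⟨y, rfl⟩ := hy
    obtain ⟨z, rfl⟩ := hz
    push_cast at *
    by_cases h0 : (x.natAbs + y.natAbs + z.natAbs) = 0
    · omega
    have h3 : cubicNorm x y z = 0 := by
      have : cubicNorm (2 * x) (2 * y) (2 * z) = 8 * cubicNorm x y z := by
        simp only [cubicNorm]; ring
      omega
    have := ih _ (by omega) x y z h3 rfl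
    omega

section Separation

variable {α : ℝ}

/-- The factorization of the norm into the real embedding and the product of the two complex ones,
which is a quadratic form in the linear forms vanishing at `(1 + α², α, 1)`. -/
theorem cubicNorm_eq_mul (hα : α ^ 3 + α = 1) (x y z : ℤ) :
    (cubicNorm x y z : ℝ) = (x + y * α + z * α ^ 2) *
      ((α ^ 2 + 1) * (y - α * z) ^ 2 - α * (y - α * z) * (x - (1 + α ^ 2) * z) +
        (x - (1 + α ^ 2) * z) ^ 2) := by
  simp only [cubicNorm]
  push_cast
  linear_combination (3 * (x : ℝ) * y * z - y ^ 3 - y * z ^ 2 - z ^ 3 * (1 + α + α ^ 3)) * hα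

/-- The vector `(α, α²)` is badly approximable. -/
theorem one_le_mul_of_abs_sub_le (hα : α ^ 3 + α = 1) {m h g : ℤ} (hm : m ≠ 0) {η : ℝ}
    (hu : |h - α * m| ≤ η) (hv : |g - α ^ 2 * m| ≤ η) : 1 ≤ (16 + 8 * η) * |(m : ℝ)| * η ^ 2 := by
  have h0 := alpha_pos hα
  have h1 := alpha_lt_one hα
  have hη : 0 ≤ η := (abs_nonneg _).trans hu
  have hN : cubicNorm (g + m) h m ≠ 0 := fun hN => hm (eq_zero_of_cubicNorm_eq_zero _ _ _ hN).2.2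
  have hN1 : (1 : ℝ) ≤ |(cubicNorm (g + m) h m : ℝ)| := by
    exact_mod_cast Int.one_le_abs hN
  have hm1 : (1 : ℝ) ≤ |(m : ℝ)| := by exact_mod_cast Int.one_le_abs hm
  set u : ℝ := h - α * m with hudef
  set v : ℝ := g - α ^ 2 * m with hvdef
  have hfac : (cubicNorm (g + m) h m : ℝ) =
      (m * (3 * α ^ 2 + 1) + u * α + v) * ((α ^ 2 + 1) * u ^ 2 - α * u * v + v ^ 2) := by
    rw [cubicNorm_eq_mul hα]
    push_cast
    simp only [hudef, hvdef]
    ring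
  have hα2 : α ^ 2 ≤ 1 := by nlinarith
  have hfirst : |m * (3 * α ^ 2 + 1) + u * α + v| ≤ (4 + 2 * η) * |(m : ℝ)| := by
    have e1 : |m * (3 * α ^ 2 + 1)| ≤ |(m : ℝ)| * 4 := by
      rw [abs_mul, abs_of_pos (show 0 < 3 * α ^ 2 + 1 by positivity)]
      gcongr; linarith
    have e2 : |u * α| ≤ η := by
      rw [abs_mul, abs_of_pos h0]
      nlinarith [abs_nonneg u]
    have e3 := abs_add_three (m * (3 * α ^ 2 + 1)) (u * α) v
    nlinarith
  have hsecond : |(α ^ 2 + 1) * u ^ 2 - α * u * v + v ^ 2| ≤ 4 * η ^ 2 := by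
    have e1 : u ^ 2 ≤ η ^ 2 := sq_le_sq' (abs_le.1 hu).1 (abs_le.1 hu).2
    have e2 : v ^ 2 ≤ η ^ 2 := sq_le_sq' (abs_le.1 hv).1 (abs_le.1 hv).2
    have e3 : |α * u * v| ≤ η ^ 2 := by
      rw [abs_mul, abs_mul, abs_of_pos h0]
      calc α * |u| * |v| ≤ 1 * η * η := by gcongr
        _ = η ^ 2 := by ring
    have e4 : 0 ≤ (1 - α ^ 2) * u ^ 2 := mul_nonneg (by linarith) (sq_nonneg u)
    have e5 : 0 ≤ α ^ 2 * u ^ 2 := by positivity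
    rw [abs_le] at e3 ⊢
    constructor <;> nlinarith [sq_nonneg u, sq_nonneg v]
  rw [hfac, abs_mul] at hN1
  calc (1 : ℝ) ≤ _ := hN1
    _ ≤ ((4 + 2 * η) * |(m : ℝ)|) * (4 * η ^ 2) := by gcongr
    _ = _ := by ring

theorem exists_int_combination_of_mem_adjoin (hα : α ^ 3 + α = 1) {β : ℝ}
    (hβ : β ∈ Algebra.adjoin ℚ ({α} : Set ℝ)) :
    ∃ d a b c : ℤ, 0 < d ∧ (d : ℝ) * β = a + b * α + c * α ^ 2 := by
  induction hβ using Algebra.adjoin_induction with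
  | mem x hx =>
    rw [Set.mem_singleton_iff] at hx
    exact ⟨1, 0, 1, 0, one_pos, by rw [hx]; simp⟩
  | algebraMap q =>
    refine ⟨q.den, q.num, 0, 0, by exact_mod_cast q.den_pos, ?_⟩
    have : (q.den : ℝ) * (q : ℝ) = q.num := by exact_mod_cast Rat.den_mul_eq_num q
    simpa using this
  | add x y _ _ hx hy =>
    obtain ⟨d, a, b, c, hd, h⟩ := hx
    obtain ⟨d', a', b', c', hd', h'⟩ := hy
    refine ⟨d * d', d' * a + d * a', d' * b + d * b', d' * c + d * c', by positivity, ?_⟩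
    push_cast
    linear_combination (d' : ℝ) * h + (d : ℝ) * h'
  | mul x y _ _ hx hy =>
    obtain ⟨d, a, b, c, hd, h⟩ := hx
    obtain ⟨d', a', b', c', hd', h'⟩ := hy
    refine ⟨d * d', a * a' + (b * c' + c * b'), a * b' + b * a' - (b * c' + c * b') + c * c',
      a * c' + b * b' + c * a' - c * c', by positivity, ?_⟩
    push_cast
    linear_combination (d' : ℝ) * y * h + (a + b * α + c * α ^ 2) * h' +
      ((b * c' + c * b' : ℝ) + c * c' * α) * hα

/-! ### Counting visits to short arcs -/

/-- The discrepancy `H n - α n`. -/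
noncomputable def discrepancy (α : ℝ) (n : ℕ) : ℝ := hofstadterH n - α * n

/-- The discrepancy `H (H n) - α² n` of the second iterate. -/
noncomputable def discrepancyTwo (α : ℝ) (n : ℕ) : ℝ := hofstadterH (hofstadterH n) - α ^ 2 * n

theorem exists_abs_discrepancy_le (hα : α ^ 3 + α = 1) :
    ∃ R, 0 ≤ R ∧ ∀ n, |discrepancy α n| ≤ R ∧ |discrepancyTwo α n| ≤ 2 * R := by
  have h0 := alpha_pos hα
  obtain ⟨R, hR0, hR⟩ := exists_abs_hofstadterH_sub_le hα
  refine ⟨R, hR0, fun n => ⟨hR n, ?_⟩⟩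
  have e1 : discrepancyTwo α n =
      discrepancy α (hofstadterH n) + α * discrepancy α n := by
    simp only [discrepancy, discrepancyTwo]; ring
  have e2 : |α * discrepancy α n| ≤ R := by
    rw [abs_mul, abs_of_pos h0]
    have h1 : |discrepancy α n| ≤ R := hR n
    nlinarith [abs_nonneg (discrepancy α n), alpha_lt_one hα]
  have e3 : |discrepancy α (hofstadterH n)| ≤ R := hR _
  rw [e1]
  linarith [abs_add_le (discrepancy α (hofstadterH n)) (α * discrepancy α n)]

/-- Up to integers, a multiple of `β H n` is a linear function of the discrepancies, and it depends on
the first one unless `β` is rational. -/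
theorem exists_eq_int_add_discrepancy (hα : α ^ 3 + α = 1) {β : ℝ} (hirr : Irrational β)
    (hβ : β ∈ Algebra.adjoin ℚ ({α} : Set ℝ)) :
    ∃ (d : ℤ) (l b : ℝ) (p : ℕ → ℤ), (0 : ℝ) < d ∧ l ≠ 0 ∧
      ∀ n, d * (β * hofstadterH n) = p n + (l * discrepancy α n - b * discrepancyTwo α n) := by
  obtain ⟨d, a, b, c, hd, habc⟩ := exists_int_combination_of_mem_adjoin hα hβ
  have hd' : (0 : ℝ) < d := by exact_mod_cast hd
  refine ⟨d, b * α + c * (α ^ 2 + 1), b, fun n =>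
    a * hofstadterH n + b * hofstadterH (hofstadterH n) + c * (n - hofstadterH n), hd',
    fun hl0 => ?_, fun n => ?_⟩
  · have h1 : (c : ℝ) + (0 : ℤ) * α + b * α ^ 2 = 0 := by
      push_cast; linear_combination α * hl0 - c * hα
    have h2 : cubicNorm c 0 b = 0 := by
      have := cubicNorm_eq_mul hα c 0 b
      rw [h1, zero_mul] at this
      exact_mod_cast this
    obtain ⟨rfl, -, rfl⟩ := eq_zero_of_cubicNorm_eq_zero _ _ _ h2
    refine hirr ⟨(a : ℚ) / d, ?_⟩
    push_cast at habc ⊢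
    rw [div_eq_iff hd'.ne']
    linarith
  · simp only [discrepancy, discrepancyTwo]
    push_cast
    linear_combination (hofstadterH n : ℝ) * habc + (c * (n : ℝ)) * hα

/-- Indices with nearby discrepancies are far apart. -/
theorem one_le_mul_of_discrepancy_close (hα : α ^ 3 + α = 1) {n n' : ℕ} (hne : n ≠ n') {C r : ℝ}
    (hC : 0 ≤ C) (hr1 : r ≤ 1) (hu : |discrepancy α n - discrepancy α n'| ≤ C * r)
    (hv : |discrepancyTwo α n - discrepancyTwo α n'| ≤ C * r) :
    1 ≤ (16 + 8 * C) * C ^ 2 * r ^ 2 * |(n : ℝ) - n'| := by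
  have hsep := one_le_mul_of_abs_sub_le hα (m := (n : ℤ) - n')
    (h := (hofstadterH n : ℤ) - hofstadterH n')
    (g := (hofstadterH (hofstadterH n) : ℤ) - hofstadterH (hofstadterH n'))
    (by omega) (η := C * r)
    (by
      convert hu using 2
      simp only [discrepancy]; push_cast; ring)
    (by
      convert hv using 2
      simp only [discrepancyTwo]; push_cast; ring)
  push_cast at hsep
  have e1 : C * r ≤ C := mul_le_of_le_one_right hC hr1
  calc 1 ≤ _ := hsep
    _ ≤ (16 + 8 * C) * |(n : ℝ) - n'| * (C * r) ^ 2 := by gcongr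
    _ = _ := by ring

/-- For irrational `β ∈ ℚ[α]`, the values `β H n` visit an arc of radius `r` with upper density
`O(r)`. Up to an integer, a fixed multiple of `β H n` is a nonconstant linear function of the bounded
vector `(H n - α n, H (H n) - α² n)`, which is thus confined to `O(1 / r)` squares of side `O(r)`;
by bad approximability, the indices `n` for which it lies in one such square have gaps of order
`r⁻²`. -/
theorem exists_card_visits_le (hα : α ^ 3 + α = 1) {β : ℝ} (hirr : Irrational β)
    (hβ : β ∈ Algebra.adjoin ℚ ({α} : Set ℝ)) :
    ∃ C : ℝ, 1 ≤ C ∧ ∀ (x : UnitAddCircle) (r : ℝ), 0 < r → r ≤ 1 → ∃ K : ℝ, ∀ N : ℕ,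
      (((Finset.range N).filter fun n =>
        ‖((β * (hofstadterH n : ℝ) : ℝ) : UnitAddCircle) - x‖ < r).card : ℝ) ≤ C * r * N + K := by
  obtain ⟨R, hR0, hRR⟩ := exists_abs_discrepancy_le hα
  obtain ⟨D, l, b, p, hd', hl0, hlin⟩ := exists_eq_int_add_discrepancy hα hirr hβ
  obtain ⟨d, hD⟩ : ∃ d : ℝ, d = D := ⟨_, rfl⟩
  simp only [← hD] at hd' hlin
  obtain ⟨δ, hδ⟩ : ∃ δ, δ = discrepancy α := ⟨_, rfl⟩
  obtain ⟨δ', hδ'⟩ : ∃ δ', δ' = discrepancyTwo α := ⟨_, rfl⟩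
  have hgap' := fun n n' => @one_le_mul_of_discrepancy_close α hα n n'
  rw [← hδ, ← hδ'] at hlin hRR hgap'
  have hR := fun n => (hRR n).1
  have hR' := fun n => (hRR n).2
  obtain ⟨B, hB⟩ : ∃ B : ℕ, B = ⌈|l| * R + |b| * (2 * R) + 2 * d⌉₊ := ⟨_, rfl⟩
  obtain ⟨C₁, hC₁⟩ : ∃ C₁ : ℝ, C₁ = 1 + (2 * d + |b|) / |l| := ⟨_, rfl⟩
  have hC₁1 : 1 ≤ C₁ := by rw [hC₁]; exact le_add_of_nonneg_right (by positivity)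
  obtain ⟨κ, hκ⟩ : ∃ κ : ℝ, κ = (16 + 8 * C₁) * C₁ ^ 2 := ⟨_, rfl⟩
  have hκ1 : 1 ≤ κ := by rw [hκ]; nlinarith
  -- `2 B + 1` integer translates, about `4 R / r` squares in each strip, and `κ r² N` indices in each
  refine ⟨(2 * B + 1) * (4 * R + 3) * κ, ?_, fun x r hr hr1 => ?_⟩
  · have e1 : (1 : ℝ) ≤ 2 * B + 1 := by linarith [Nat.cast_nonneg (α := ℝ) B]
    have e2 : (1 : ℝ) ≤ 4 * R + 3 := by linarith
    exact one_le_mul_of_one_le_of_one_le (one_le_mul_of_one_le_of_one_le e1 e2) hκ1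
  obtain ⟨x, ⟨hx0, hx1⟩, rfl⟩ : x ∈ ((↑) : ℝ → UnitAddCircle) '' Set.Ico 0 (0 + 1) := by
    rw [AddCircle.coe_image_Ico_eq]; trivial
  rw [zero_add] at hx1
  obtain ⟨M, hM⟩ : ∃ M : ℕ, M = ⌈2 * R / r⌉₊ := ⟨_, rfl⟩
  -- `q n` locates the linear function of the discrepancies modulo the period
  obtain ⟨q, hq⟩ : ∃ q : ℕ → ℤ, ∀ n, q n = D * round (β * hofstadterH n - x) - p n :=
    ⟨_, fun _ => rfl⟩
  refine ⟨(2 * B + 1) * (2 * M + 1), fun N => ?_⟩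
  set s := (Finset.range N).filter fun n =>
    ‖((β * (hofstadterH n : ℝ) : ℝ) : UnitAddCircle) - x‖ < r with hs
  have hsq : ∀ n ∈ s, |l * δ n - b * δ' n - d * x - q n| < d * r := fun n hn => by
    have hn' := (Finset.mem_filter.1 hn).2
    rw [← AddCircle.coe_sub, UnitAddCircle.norm_eq] at hn'
    have e : l * δ n - b * δ' n - d * x - q n =
        d * (β * hofstadterH n - x - round (β * hofstadterH n - x)) := by
      rw [hq]; push_cast; rw [← hD]; linear_combination -hlin n
    rw [e, abs_mul, abs_of_pos hd']
    gcongr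
  set T : Finset (ℤ × ℤ × ℕ) := Finset.Icc (-B : ℤ) B ×ˢ Finset.Icc (-M : ℤ) M ×ˢ
    Finset.range (⌊κ * r ^ 2 * N⌋₊ + 1) with hT
  have hcard : s.card ≤ T.card := by
    refine Finset.card_le_card_of_injOn (fun n => (q n, ⌊δ' n / r⌋, ⌊κ * r ^ 2 * n⌋₊)) ?_ ?_
    · intro n hn
      have hnN := Finset.mem_range.1 (Finset.mem_filter.1 hn).1
      simp only [hT, Finset.coe_product, Set.mem_prod, Finset.mem_coe, Finset.mem_Icc,
        Finset.mem_range]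
      refine ⟨?_, ?_, ?_⟩
      · have e1 := abs_lt.1 (hsq n hn)
        have e2 : |l * δ n| ≤ |l| * R := by rw [abs_mul]; gcongr; exact hR n
        have e3 : |b * δ' n| ≤ |b| * (2 * R) := by rw [abs_mul]; gcongr; exact hR' n
        have e4 := Nat.le_ceil (|l| * R + |b| * (2 * R) + 2 * d)
        rw [← hB] at e4
        rw [abs_le] at e2 e3
        have e5 : d * r ≤ d := mul_le_of_le_one_right hd'.le hr1
        have e6 : d * x ≤ d := mul_le_of_le_one_right hd'.le hx1.le
        have e7 : 0 ≤ d * x := mul_nonneg hd'.le hx0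
        rw [← Int.cast_le (R := ℝ), ← Int.cast_le (R := ℝ)]
        push_cast
        constructor <;> linarith
      · have e1 := abs_le.1 (hR' n)
        have e2 := Nat.le_ceil (2 * R / r)
        rw [← hM] at e2
        have e3 : -(2 * R / r) ≤ δ' n / r := by
          rw [← neg_div]; gcongr; exact e1.1
        have e4 : δ' n / r ≤ 2 * R / r := by gcongr; exact e1.2
        constructor
        · rw [Int.le_floor]; push_cast; linarith
        · rw [← Int.cast_le (R := ℝ)]
          push_cast
          linarith [Int.floor_le (δ' n / r)]
      · refine Nat.lt_succ_of_le (Nat.floor_le_floor ?_)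
        gcongr
    · intro n hn n' hn' heq
      simp only [Prod.mk.injEq] at heq
      obtain ⟨hqq, hfl, ht⟩ := heq
      by_contra hne
      have hv : |δ' n - δ' n'| ≤ r := by
        have := Int.abs_sub_lt_one_of_floor_eq_floor hfl
        rw [← sub_div, abs_div, abs_of_pos hr, div_lt_one hr] at this
        exact this.le
      have hu : |δ n - δ n'| ≤ (2 * d + |b|) / |l| * r := by
        have e1 := abs_lt.1 (hsq n hn)
        have e2 := abs_lt.1 (hsq n' hn')
        rw [hqq] at e1
        have e3 : |b * (δ' n - δ' n')| ≤ |b| * r := by rw [abs_mul]; gcongr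
        rw [abs_le] at e3
        have e4 : |l * (δ n - δ n')| ≤ (2 * d + |b|) * r := by
          rw [abs_le]; constructor <;> nlinarith
        rw [abs_mul] at e4
        rw [div_mul_eq_mul_div, le_div_iff₀ (abs_pos.2 hl0)]
        linarith
      have hgap : κ * r ^ 2 * |(n : ℝ) - n'| < 1 := by
        have e1 := Nat.floor_le (show 0 ≤ κ * r ^ 2 * n by positivity)
        have e2 := Nat.lt_floor_add_one (κ * r ^ 2 * n)
        have e3 := Nat.floor_le (show 0 ≤ κ * r ^ 2 * n' by positivity)
        have e4 := Nat.lt_floor_add_one (κ * r ^ 2 * n')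
        rw [ht] at e1 e2
        rw [← abs_of_pos (show 0 < κ * r ^ 2 by positivity), ← abs_mul, abs_lt]
        constructor <;> linarith
      have hsep := hgap' n n' hne (zero_le_one.trans hC₁1) hr1
        (hu.trans (by rw [hC₁]; linarith)) (hv.trans (by nlinarith))
      rw [← hκ] at hsep
      linarith
  have hTcard : (T.card : ℝ) = (2 * B + 1) * ((2 * M + 1) * (⌊κ * r ^ 2 * N⌋₊ + 1)) := by
    have e : ∀ k : ℕ, ((k : ℤ) + 1 - -(k : ℤ)).toNat = 2 * k + 1 := fun k => by omega
    rw [hT, Finset.card_product, Finset.card_product, Int.card_Icc, Int.card_Icc,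
      Finset.card_range, e, e]
    push_cast
    ring
  have hMr : (2 * (M : ℝ) + 1) * r ≤ 4 * R + 3 := by
    have e1 := Nat.ceil_lt_add_one (show 0 ≤ 2 * R / r by positivity)
    rw [← hM] at e1
    have e2 : 2 * R / r * r = 2 * R := div_mul_cancel₀ _ hr.ne'
    nlinarith
  have hfloor := Nat.floor_le (show 0 ≤ κ * r ^ 2 * N by positivity)
  calc (s.card : ℝ) ≤ T.card := by exact_mod_cast hcard
    _ ≤ (2 * B + 1) * ((2 * M + 1) * (κ * r ^ 2 * N + 1)) := by rw [hTcard]; gcongr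
    _ = (2 * B + 1) * ((2 * M + 1) * r) * κ * (r * N) + (2 * B + 1) * (2 * M + 1) := by ring
    _ ≤ (2 * B + 1) * (4 * R + 3) * κ * (r * N) + (2 * B + 1) * (2 * M + 1) := by gcongr
    _ = _ := by ring

end Separation

/-! ### The limit distribution -/

theorem empiricalMeasure_apply (a : ℕ → UnitAddCircle) (N : ℕ) {s : Set UnitAddCircle}
    (hs : MeasurableSet s) [DecidablePred fun n => a n ∈ s] :
    empiricalMeasure a N s =
      (N : ENNReal)⁻¹ * ((Finset.range N).filter fun n => a n ∈ s).card := by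
  rw [empiricalMeasure, Measure.smul_apply, smul_eq_mul, Measure.finsetSum_apply]
  congr 1
  simp only [Measure.dirac_apply' _ hs, Set.indicator_apply, Pi.one_apply]
  rw [Finset.sum_boole]

/-- A limit distribution gives an open set at most the upper density of the visits to it. -/
theorem measure_le_of_card_visits_le {a : ℕ → UnitAddCircle} {μ : ProbabilityMeasure UnitAddCircle}
    (hμ : DistributionTendsto a μ) {s : Set UnitAddCircle} (hs : IsOpen s)
    [DecidablePred fun n => a n ∈ s] {D K : ℝ}
    (h : ∀ N : ℕ, (((Finset.range N).filter fun n => a n ∈ s).card : ℝ) ≤ D * N + K) :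
    (μ : Measure UnitAddCircle) s ≤ ENNReal.ofReal D := by
  refine (ProbabilityMeasure.le_liminf_measure_open_of_tendsto hμ hs).trans ?_
  have hlim : Tendsto (fun N : ℕ => ENNReal.ofReal (D + K / (N + 1))) atTop
      (𝓝 (ENNReal.ofReal D)) := by
    refine ENNReal.tendsto_ofReal ?_
    have := (tendsto_const_div_atTop_nhds_zero_nat K).comp (tendsto_add_atTop_nat 1)
    simpa [Function.comp_def] using this.const_add D
  rw [← hlim.liminf_eq]
  refine liminf_le_liminf (Eventually.of_forall fun N => ?_)
  change empiricalMeasure a (N + 1) s ≤ _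
  have hN : (0 : ℝ) < (N + 1 : ℕ) := by exact_mod_cast N.succ_pos
  rw [empiricalMeasure_apply a _ hs.measurableSet, ← ENNReal.ofReal_natCast (N + 1),
    ← ENNReal.ofReal_inv_of_pos hN, ← ENNReal.ofReal_natCast (Finset.card _),
    ← ENNReal.ofReal_mul (inv_nonneg.2 hN.le)]
  refine ENNReal.ofReal_le_ofReal ?_
  rw [inv_mul_le_iff₀ hN]
  refine (h (N + 1)).trans_eq ?_
  push_cast at hN ⊢
  field_simp

theorem fourier_mul_hofstadterH (β : ℝ) (k : ℤ) (n : ℕ) :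
    fourier k ((β * (hofstadterH n : ℝ) : ℝ) : UnitAddCircle) =
      Complex.exp (2 * Real.pi * Complex.I * (k * β * hofstadterH n : ℝ)) := by
  rw [fourier_coe_apply]
  congr 1
  push_cast
  ring

theorem theorem1 (α β : ℝ) (hα : α ^ 3 + α = 1) (hβ : Irrational β) :
    (β ∈ Algebra.adjoin ℚ ({α} : Set ℝ) →
      ∃ μ : ProbabilityMeasure UnitAddCircle,
        (μ : Measure UnitAddCircle) ≪ volume ∧
        DistributionTendsto (fun n => ((β * (hofstadterH n : ℝ) : ℝ) : UnitAddCircle)) μ) ∧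
    (β ∉ Algebra.adjoin ℚ ({α} : Set ℝ) →
      DistributionTendsto (fun n => ((β * (hofstadterH n : ℝ) : ℝ) : UnitAddCircle))
        uniformCircle) := by
  classical
  choose c hc hcne using fun k : ℤ => exists_tendsto_exp_mean hα (k * β)
  simp_rw [← fourier_mul_hofstadterH] at hc
  refine ⟨fun hmem => ?_, fun hmem => ?_⟩
  · obtain ⟨μ, hμ, -⟩ := exists_distributionTendsto hc
    refine ⟨μ, ?_, hμ⟩
    obtain ⟨C, hC1, hC⟩ := exists_card_visits_le hα hβ hmem
    refine absolutelyContinuous_of_measure_ball_le (zero_lt_one.trans_le hC1) fun x r hr => ?_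
    rcases le_or_gt r 1 with hr1 | hr1
    · obtain ⟨K, hK⟩ := hC x r hr hr1
      simp_rw [← dist_eq_norm, ← Metric.mem_ball] at hK
      exact measure_le_of_card_visits_le hμ Metric.isOpen_ball hK
    · refine prob_le_one.trans ?_
      rw [ENNReal.one_le_ofReal]
      exact one_le_mul_of_one_le_of_one_le hC1 hr1.le
  · refine distributionTendsto_uniformCircle fun k hk => ?_
    suffices h : c k = 0 from h ▸ hc k
    by_contra hck
    refine hmem ?_
    have hk' : (k : ℝ) ≠ 0 := by exact_mod_cast hk
    have := (Algebra.adjoin ℚ ({α} : Set ℝ)).smul_mem (hcne k hck) ((k : ℚ)⁻¹)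
    rwa [Rat.smul_def, Rat.cast_inv, Rat.cast_intCast, inv_mul_cancel_left₀ hk'] at this
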